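/- Let $S_0,S_1$ be measurable spaces whose singletons are measurable, and let $\mu$ be a measure on $S_0\times S_1$ that is countable in Kingman's sense, i.e. $\mu=\sum_{n\ge1}\mu^{(n)}$ with $\mu^{(n)}(S_0\times S_1)<\infty$ for all $n$. Write $\mu_1(A)=\mu(S_0\times A)$. Let $Z=(X,Y)=\{(X_i,Y_i)\}$ be a Poisson process with mean measure $\mu$: a random countable collection of points of $S_0\times S_1$ (points being counted with multiplicity) such that for disjoint measurable sets $B_1,\dots,B_n$ the counts $\#(Z\cap B_j)$ are independent random variables with $\#(Z\cap B_j)\sim\mathrm{Po}(\mu(B_j))$, where $\mathrm{Po}(\infty)$ is the unit mass at $\infty$. A conditional kernel of $\mu$ is a Markov kernel $\mu(dx\mid y)$ from $S_1$ to $S_0$ with $$\mu(B\times A)=\int_A\mu(B\mid y)\,\mu_1(dy)$$ for all measurable $B\subset S_0$ and all measurable $A\subset S_1$ with $\mu_1(A)<\infty$. (a) If $S_0$ is a non-empty standard Borel space, a conditional kernel of $\mu$ exists. (b) Let $\mu(dx\mid y)$ be any conditional kernel of $\mu$. Let $A\subset S_1$ be measurable with $0<\mu_1(A)<\infty$ and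 let $m\ge0$ be an integer. The event $\#(Y\cap A)=m$ has positive probability. Condition on this event, and let $(X_1,Y_1),\dots,(X_m,Y_m)$ be the points of $Z$ in $S_0\times A$, labelled by a uniform random permutation independent of $Z$ (more precisely: obtained from a measurable labelling of these points by a uniform random permutation of the labels that is independent of $Z$ and of that labelling). Then: 1. the conditional law of $(X_1,\dots,X_m)$ given $(Y_1,\dots,Y_m)=(y_1,\dots,y_m)$ is $\prod_{i=1}^m\mu(dx_i\mid y_i)$; 2. (conditional independence) $X_1,\dots,X_m$ are conditionally independent given $(Y_1,\dots,Y_m)$; 3. (lack of interference) for each $i$, the conditional law of $X_i$ given $(Y_1,\dots,Y_m)$ is $\mu(dx\mid Y_i)$; it depends only on $Y_i$, not on the other events, on their number, or on the test set $A$, since the kernel $\mu(dx\mid y)$ is fixed independently of $A$ and $m$. -/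

import Mathlib

open MeasureTheory ProbabilityTheory Set
open scoped ENNReal NNReal ProbabilityTheory

noncomputable section

/-- The Poisson distribution `Po(r)` on `{0, 1, 2, …, ∞}`, for `r ∈ [0, ∞]`: the usual one if
`r < ∞`, and the unit mass at `∞` if `r = ∞`. -/
def poissonLaw (r : ℝ≥0∞) : Measure ℝ≥0∞ :=
  if r = ∞ then Measure.dirac ∞ else (poissonMeasure r.toNNReal).map (fun n : ℕ => (n : ℝ≥0∞))

/-- `Z ∼ PP(μ)`. The random countable collection of events `Z` is encoded by its counting measure:
`Z ω B = #(Z ∩ B)` is the number of events in `B`, repeated events being counted with their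
multiplicity. A random countable subset is the special case in which the events are distinct. -/
structure IsPoissonProcess {S Ω : Type*} [MeasurableSpace S] [MeasurableSpace Ω]
    (Z : Ω → Measure S) (μ : Measure S) (P : Measure Ω) : Prop where
  /-- `Z` consists of countably many events `z i`, `i ∈ I`, almost surely. -/
  countable_events : ∀ᵐ ω ∂P, ∃ (I : Set ℕ) (z : I → S),
    Z ω = Measure.sum fun i => Measure.dirac (z i)
  /-- The numbers of events in measurable sets are random variables. -/
  measurable_count : ∀ B, MeasurableSet B → Measurable fun ω => Z ω B
  /-- `#(Z ∩ B) ∼ Po(μ(B))`. -/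
  law_count : ∀ B, MeasurableSet B → P.map (fun ω => Z ω B) = poissonLaw (μ B)
  /-- The numbers of events in disjoint sets are independent. -/
  indep_count : ∀ (n : ℕ) (B : Fin n → Set S), (∀ j, MeasurableSet (B j)) →
    Pairwise (fun j k => Disjoint (B j) (B k)) → iIndepFun (fun j ω => Z ω (B j)) P

/-- The kernel `κ y = μ(dx | y) = μ(dx × dy) / μ₁(dy)`: for every measurable `B ⊆ S₀`, the function
`y ↦ κ y B` is a density of `μ(B × dy)` with respect to the marginal `μ₁ = μ.snd`, on every
measurable set of finite `μ₁`-measure. -/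
def IsConditionalKernel {S₀ S₁ : Type*} [MeasurableSpace S₀] [MeasurableSpace S₁]
    (μ : Measure (S₀ × S₁)) (κ : Kernel S₁ S₀) : Prop :=
  ∀ A, MeasurableSet A → μ.snd A < ∞ → ∀ B, MeasurableSet B →
    μ (B ×ˢ A) = ∫⁻ y in A, κ y B ∂μ.snd

/-- The event that exactly `m` points of the projected process `Y` lie in `A`: `#(Y ∩ A) = m`. -/
def observedCount {S₀ S₁ Ω : Type*} [MeasurableSpace S₀] [MeasurableSpace S₁]
    (Z : Ω → Measure (S₀ × S₁)) (A : Set S₁) (m : ℕ) : Set Ω :=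
  {ω | (Z ω).snd A = m}

/-- On the event `#(Y ∩ A) = m`, the events `(X₁, Y₁), …, (Xₘ, Yₘ)` of `Z` with `Yᵢ ∈ A` are labelled
by a uniform random permutation independent of `Z`: there are an initial measurable labelling
`(W₁, …, Wₘ)` of these events and a uniform random permutation `σ`, independent of `Z` and of the
initial labelling, with `(Xᵢ, Yᵢ) = W_{σ(i)}`. -/
def IsUniformLabelling {S₀ S₁ Ω : Type*} [MeasurableSpace S₀] [MeasurableSpace S₁]
    [MeasurableSpace Ω] (P : Measure Ω) (Z : Ω → Measure (S₀ × S₁)) (A : Set S₁) (m : ℕ)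
    (X : Ω → Fin m → S₀) (Y : Ω → Fin m → S₁) : Prop :=
  ∃ (W : Ω → Fin m → S₀ × S₁) (σ : Ω → Equiv.Perm (Fin m)),
    Measurable W ∧
    (∀ᵐ ω ∂P[|observedCount Z A m],
      (Z ω).restrict (Prod.snd ⁻¹' A) = ∑ i, Measure.dirac (W ω i)) ∧
    (∀ τ, MeasurableSet (σ ⁻¹' {τ})) ∧
    (∀ τ, P[|observedCount Z A m] (σ ⁻¹' {τ}) = (m.factorial : ℝ≥0∞)⁻¹) ∧
    Indep (MeasurableSpace.comap σ ⊤)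
      (MeasurableSpace.comap (fun ω => (Z ω, W ω)) inferInstance) P[|observedCount Z A m] ∧
    ∀ ω i, (X ω i, Y ω i) = W ω (σ ω i)

/-- The product kernel `(y₁, …, yₘ) ↦ ∏ᵢ κ(dxᵢ | yᵢ)`. -/
def productKernel {S₀ S₁ : Type*} [MeasurableSpace S₀] [MeasurableSpace S₁]
    (κ : Kernel S₁ S₀) [IsMarkovKernel κ] (m : ℕ) : Kernel (Fin m → S₁) (Fin m → S₀) where
  toFun y := Measure.pi fun i => κ (y i)
  measurable' := by
    refine Measurable.measure_of_isPiSystem_of_isProbabilityMeasure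
      generateFrom_pi.symm isPiSystem_pi ?_
    rintro _ ⟨B, hB, rfl⟩
    simp only [Measure.pi_pi]
    exact Finset.measurable_prod _ fun i _ =>
      (κ.measurable_coe (hB i (mem_univ i))).comp (measurable_pi_apply i)

end

/-!
Let `T = S₀ × A`. Given that `T` contains exactly `m` points, the numbers of points in the cells of
a finite measurable partition of `T` are multinomial with the cell probabilities of `μ(· | T)`. A
finite-valued function of the labelled points is a word of length `m`, and a uniform relabelling
makes all words with the same letter counts equally likely: the permutations act transitively on
them, so each is hit by as many permutations as its stabilizer has elements, a product of
factorials. This cancels the multinomial coefficient, so that the words, and hence the labelled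
points themselves, are i.i.d. with law `μ(· | T)`. By the defining property of a conditional kernel
each point disintegrates as `μ₁(dy | A) μ(dx | y)`, and a product of disintegrations is the
disintegration of the product.
-/

section UniformGroupElement

variable {Ω G X : Type*} [MeasurableSpace Ω]

/-- The random element `g` of the finite set `G` is uniformly distributed and independent of the
random variable `W`. The set `G` carries the discrete σ-algebra, passed explicitly because
permutation groups have no measurable structure in the library. -/
structure IsIndepUniform {β : Type*} [Fintype G] [MeasurableSpace β] (g : Ω → G) (W : Ω → β)
    (Q : Measure Ω) : Prop where
  measurableSet_fiber : ∀ a, MeasurableSet (g ⁻¹' {a})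
  measure_fiber : ∀ a, Q (g ⁻¹' {a}) = (Fintype.card G : ℝ≥0∞)⁻¹
  indep : Indep (MeasurableSpace.comap g ⊤) (MeasurableSpace.comap W inferInstance) Q

namespace IsIndepUniform

variable {β γ H : Type*} [Fintype G] [Fintype H] [MeasurableSpace β] [MeasurableSpace γ]
  {g : Ω → G} {W : Ω → β} {Q : Measure Ω}

theorem comp_right (h : IsIndepUniform g W Q) {f : β → γ} (hf : Measurable f) :
    IsIndepUniform g (f ∘ W) Q where
  measurableSet_fiber := h.measurableSet_fiber
  measure_fiber := h.measure_fiber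
  indep := indep_of_indep_of_le_right h.indep <| by
    rw [← MeasurableSpace.comap_comp]
    exact MeasurableSpace.comap_mono hf.comap_le

theorem equiv_comp_left (h : IsIndepUniform g W Q) (e : G ≃ H) : IsIndepUniform (e ∘ g) W Q where
  measurableSet_fiber b := by
    simpa only [preimage_comp, ← e.image_symm_eq_preimage, image_singleton]
      using h.measurableSet_fiber (e.symm b)
  measure_fiber b := by
    simpa only [preimage_comp, ← e.image_symm_eq_preimage, image_singleton, Fintype.card_congr e]
      using h.measure_fiber (e.symm b)
  indep := indep_of_indep_of_le_left h.indep <| by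
    rw [← MeasurableSpace.comap_comp]
    exact MeasurableSpace.comap_mono le_top

theorem measure_inter_preimage (h : IsIndepUniform g W Q) (a : G) {B : Set β}
    (hB : MeasurableSet B) :
    Q (g ⁻¹' {a} ∩ W ⁻¹' B) = (Fintype.card G : ℝ≥0∞)⁻¹ * Q (W ⁻¹' B) := by
  rw [← h.measure_fiber a]
  exact (Indep_iff _ _ _).mp h.indep _ _ ⟨{a}, trivial, rfl⟩ ⟨B, hB, rfl⟩

end IsIndepUniform

theorem sum_smul_eq_card_stabilizer_mul_sum_orbit {R : Type*} [NonAssocSemiring R] [Group G]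
    [Fintype G] [MulAction G X] (x : X) [Fintype (MulAction.orbit G x)]
    [Fintype (MulAction.stabilizer G x)] (f : X → R) :
    ∑ a : G, f (a • x) =
      Fintype.card (MulAction.stabilizer G x) * ∑ y : MulAction.orbit G x, f y := by
  have hsmul (a : G) : f (a • x) = f ((MulAction.orbitProdStabilizerEquivGroup G x).symm a).1 := rfl
  simp only [hsmul]
  rw [(MulAction.orbitProdStabilizerEquivGroup G x).symm.sum_comp fun p => f p.1,
    Fintype.sum_prod_type]
  simp only [Finset.sum_const, Finset.card_univ, nsmul_eq_mul, Finset.mul_sum]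

theorem IsIndepUniform.card_mul_measure_smul_eq [Group G] [Fintype G] [MulAction G X]
    [MeasurableSpace X] [MeasurableSingletonClass X] {g : Ω → G} {u : Ω → X} {Q : Measure Ω}
    (h : IsIndepUniform g u Q) (hu : Measurable u) (x : X)
    [Fintype (MulAction.stabilizer G x)] :
    Fintype.card G * Q {ω | g ω • u ω = x} =
      Fintype.card (MulAction.stabilizer G x) * Q (u ⁻¹' MulAction.orbit G x) := by
  classical
  have : Fintype (MulAction.orbit G x) := (Set.finite_range fun a : G => a • x).fintype
  have hevent : {ω | g ω • u ω = x} = ⋃ a, g ⁻¹' {a} ∩ u ⁻¹' {a⁻¹ • x} := by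
    ext ω
    simp [eq_inv_smul_iff]
  have horbit : u ⁻¹' MulAction.orbit G x = ⋃ y : MulAction.orbit G x, u ⁻¹' {(y : X)} := by
    ext ω
    simp
  have hcard : (Fintype.card G : ℝ≥0∞) ≠ 0 := by simp
  calc Fintype.card G * Q {ω | g ω • u ω = x}
      = Fintype.card G * ∑ a, Q (g ⁻¹' {a} ∩ u ⁻¹' {a⁻¹ • x}) := by
        rw [hevent, measure_iUnion, tsum_fintype]
        · exact fun a b hab => (disjoint_singleton.mpr hab).preimage g |>.mono
            inter_subset_left inter_subset_left
        · exact fun a => (h.measurableSet_fiber a).inter (hu (measurableSet_singleton _))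
    _ = ∑ a : G, Q (u ⁻¹' {a⁻¹ • x}) := by
        simp_rw [h.measure_inter_preimage _ (measurableSet_singleton _), ← Finset.mul_sum]
        rw [← mul_assoc, ENNReal.mul_inv_cancel hcard (ENNReal.natCast_ne_top _), one_mul]
    _ = ∑ a : G, Q (u ⁻¹' {a • x}) :=
        Equiv.sum_comp (Equiv.inv G) fun a => Q (u ⁻¹' {a • x})
    _ = Fintype.card (MulAction.stabilizer G x) * ∑ y : MulAction.orbit G x, Q (u ⁻¹' {(y : X)}) :=
        sum_smul_eq_card_stabilizer_mul_sum_orbit x fun y => Q (u ⁻¹' {y})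
    _ = Fintype.card (MulAction.stabilizer G x) * Q (u ⁻¹' MulAction.orbit G x) := by
        rw [horbit, measure_iUnion, tsum_fintype]
        · exact fun y z hyz => (disjoint_singleton.mpr (Subtype.coe_ne_coe.mpr hyz)).preimage u
        · exact fun y => hu (measurableSet_singleton _)

end UniformGroupElement

section Occurrences

open scoped Nat

variable {α ι : Type*} [Fintype α] [DecidableEq ι]

/-- The number of occurrences of the letter `s` in the word `w`, the letters of which are indexed
by `α`. -/
def occurrences (w : α → ι) (s : ι) : ℕ := Fintype.card {a // w a = s}

theorem sum_occurrences [Fintype ι] (w : α → ι) : ∑ s, occurrences w s = Fintype.card α := by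
  simp only [occurrences]
  rw [← Fintype.card_sigma, Fintype.card_congr (Equiv.sigmaFiberEquiv w)]

theorem prod_pow_occurrences [Fintype ι] {M : Type*} [CommMonoid M] (w : α → ι) (p : ι → M) :
    ∏ s, p s ^ occurrences w s = ∏ a, p (w a) := by
  rw [← Finset.prod_fiberwise Finset.univ w]
  refine Finset.prod_congr rfl fun s _ => ?_
  rw [Finset.prod_congr rfl fun a ha => by rw [(Finset.mem_filter.mp ha).2], Finset.prod_const,
    occurrences, Fintype.card_subtype]

theorem mem_orbit_perm_iff_occurrences_eq {w v : α → ι} :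
    w ∈ MulAction.orbit (Equiv.Perm α)ᵈᵐᵃ v ↔ occurrences w = occurrences v := by
  constructor
  · rintro ⟨τ, rfl⟩
    funext s
    exact Fintype.card_congr ((DomMulAct.mk.symm τ).subtypeEquiv fun a => Iff.rfl)
  · intro h
    let e s : {a // w a = s} ≃ {a // v a = s} := Fintype.equivOfCardEq (congrFun h s)
    exact ⟨DomMulAct.mk (Equiv.ofFiberEquiv e), funext fun a => Equiv.ofFiberEquiv_map e a⟩

theorem card_stabilizer_perm_eq_prod_factorial [Fintype ι] (w : α → ι)
    [Fintype (MulAction.stabilizer (Equiv.Perm α)ᵈᵐᵃ w)] :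
    Fintype.card (MulAction.stabilizer (Equiv.Perm α)ᵈᵐᵃ w) = ∏ s, (occurrences w s)! := by
  classical
  refine Eq.trans ?_ (DomMulAct.stabilizer_card w)
  exact Fintype.card_congr (DomMulAct.mk.symm.subtypeEquiv fun τ => Iff.rfl)

theorem IsIndepUniform.multinomial_mul_measureReal_comp_perm_eq {Ω : Type*} [MeasurableSpace Ω]
    [DecidableEq α] [Fintype ι] [MeasurableSpace ι] [MeasurableSingletonClass ι]
    {Q : Measure Ω} {u : Ω → α → ι} {σ : Ω → Equiv.Perm α} (h : IsIndepUniform σ u Q)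
    (hu : Measurable u) (v : α → ι) :
    Nat.multinomial Finset.univ (occurrences v) * Q.real {ω | u ω ∘ σ ω = v} =
      Q.real {ω | occurrences (u ω) = occurrences v} := by
  classical
  have : Fintype (Equiv.Perm α)ᵈᵐᵃ := Fintype.ofEquiv _ DomMulAct.mk
  have horbit : u ⁻¹' MulAction.orbit (Equiv.Perm α)ᵈᵐᵃ v =
      {ω | occurrences (u ω) = occurrences v} :=
    ext fun ω => mem_orbit_perm_iff_occurrences_eq
  have hcard : Fintype.card (Equiv.Perm α)ᵈᵐᵃ =
      (∏ s, (occurrences v s)!) * Nat.multinomial Finset.univ (occurrences v) := by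
    rw [Nat.multinomial_spec, sum_occurrences, ← Fintype.card_perm,
      Fintype.card_congr DomMulAct.mk.symm]
  have hsmul := congrArg ENNReal.toReal <|
    (h.equiv_comp_left DomMulAct.mk).card_mul_measure_smul_eq hu v
  rw [horbit, card_stabilizer_perm_eq_prod_factorial, hcard, ENNReal.toReal_mul,
    ENNReal.toReal_mul, ENNReal.toReal_natCast, ENNReal.toReal_natCast, Nat.cast_mul,
    mul_assoc] at hsmul
  exact mul_left_cancel₀ (by positivity) hsmul

end Occurrences

theorem measureReal_cond_apply {Ω : Type*} [MeasurableSpace Ω] (μ : Measure Ω) {s : Set Ω}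
    (hs : MeasurableSet s) (t : Set Ω) : μ[|s].real t = (μ.real s)⁻¹ * μ.real (s ∩ t) := by
  simp_rw [measureReal_def, cond_apply hs, ENNReal.toReal_mul, ENNReal.toReal_inv]

section Poisson

open scoped Nat

theorem poissonLaw_real_singleton_natCast {r : ℝ≥0∞} (hr : r ≠ ∞) (n : ℕ) :
    (poissonLaw r).real {(n : ℝ≥0∞)} = Real.exp (-r.toReal) * r.toReal ^ n / n ! := by
  have hpre : (fun n : ℕ => (n : ℝ≥0∞)) ⁻¹' {(n : ℝ≥0∞)} = {n} := by
    ext k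
    simp
  rw [poissonLaw, if_neg hr, map_measureReal_apply measurable_from_top (measurableSet_singleton _),
    hpre, poissonMeasure_real_singleton]
  rfl

theorem inv_poisson_mul_prod_poisson_eq_multinomial {ι : Type*} [Fintype ι] (a : ι → ℝ)
    (ha : ∑ s, a s ≠ 0) (n : ι → ℕ) :
    (Real.exp (-∑ s, a s) * (∑ s, a s) ^ (∑ s, n s) / (∑ s, n s)!)⁻¹ *
        ∏ s, Real.exp (-a s) * a s ^ n s / (n s)! =
      Nat.multinomial Finset.univ n * ∏ s, (a s / ∑ t, a t) ^ n s := by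
  have hprod : ∏ s, Real.exp (-a s) * a s ^ n s / (n s)! =
      Real.exp (-∑ s, a s) * (∏ s, a s ^ n s) / ∏ s, ((n s)! : ℝ) := by
    rw [Finset.prod_div_distrib, Finset.prod_mul_distrib, ← Real.exp_sum, Finset.sum_neg_distrib]
  have hpow : ∏ s, (a s / ∑ t, a t) ^ n s = (∏ s, a s ^ n s) / (∑ t, a t) ^ (∑ s, n s) := by
    simp_rw [div_pow, Finset.prod_div_distrib, Finset.prod_pow_eq_pow_sum]
  have hmultinomial : (∏ s, ((n s)! : ℝ)) * Nat.multinomial Finset.univ n = (∑ s, n s)! := by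
    exact_mod_cast Nat.multinomial_spec Finset.univ n
  rw [hprod, hpow, ← hmultinomial]
  field_simp

end Poisson

namespace IsPoissonProcess

open scoped Nat

variable {S Ω : Type*} [MeasurableSpace S] [MeasurableSpace Ω] {Z : Ω → Measure S}
  {μ : Measure S} {P : Measure Ω}

theorem measurableSet_count_eq (hZ : IsPoissonProcess Z μ P) {B : Set S} (hB : MeasurableSet B)
    (n : ℕ) : MeasurableSet {ω | Z ω B = n} :=
  hZ.measurable_count B hB (measurableSet_singleton _)

theorem measureReal_count_eq (hZ : IsPoissonProcess Z μ P) {B : Set S} (hB : MeasurableSet B)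
    (hμB : μ B ≠ ∞) (n : ℕ) :
    P.real {ω | Z ω B = n} = Real.exp (-μ.real B) * μ.real B ^ n / n ! := by
  rw [measureReal_def μ, ← poissonLaw_real_singleton_natCast hμB, ← hZ.law_count B hB,
    map_measureReal_apply (hZ.measurable_count B hB) (measurableSet_singleton _)]
  rfl

theorem measureReal_count_eq_pos (hZ : IsPoissonProcess Z μ P) {B : Set S} (hB : MeasurableSet B)
    (hμB₀ : μ B ≠ 0) (hμB : μ B ≠ ∞) (n : ℕ) : 0 < P.real {ω | Z ω B = n} := by
  have hμB_pos : 0 < μ.real B := ENNReal.toReal_pos hμB₀ hμB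
  rw [hZ.measureReal_count_eq hB hμB]
  positivity

theorem iIndepFun_count (hZ : IsPoissonProcess Z μ P) {ι : Type*} [Finite ι] {B : ι → Set S}
    (hB : ∀ s, MeasurableSet (B s)) (hd : Pairwise (Function.onFun Disjoint B)) :
    iIndepFun (fun s ω => Z ω (B s)) P := by
  obtain ⟨n, ⟨e⟩⟩ := Finite.exists_equiv_fin ι
  simpa using (hZ.indep_count n (fun j => B (e.symm j)) (fun j => hB _)
    fun j k hjk => hd (e.symm.injective.ne hjk)).precomp e.injective

theorem measureReal_forall_count_eq (hZ : IsPoissonProcess Z μ P) {ι : Type*} [Fintype ι]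
    {B : ι → Set S} (hB : ∀ s, MeasurableSet (B s)) (hd : Pairwise (Function.onFun Disjoint B))
    (n : ι → ℕ) :
    P.real {ω | ∀ s, Z ω (B s) = n s} = ∏ s, P.real {ω | Z ω (B s) = n s} := by
  simp_rw [measureReal_def, ← ENNReal.toReal_prod, ofPred_forall]
  exact congrArg ENNReal.toReal <| (hZ.iIndepFun_count hB hd).meas_iInter
    fun s => ⟨{(n s : ℝ≥0∞)}, measurableSet_singleton _, rfl⟩

theorem cond_count_iUnion_eq_multinomial (hZ : IsPoissonProcess Z μ P) {ι : Type*} [Fintype ι]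
    {B : ι → Set S} (hB : ∀ s, MeasurableSet (B s)) (hd : Pairwise (Function.onFun Disjoint B))
    (hμ₀ : μ (⋃ s, B s) ≠ 0) (hμ : μ (⋃ s, B s) ≠ ∞) (n : ι → ℕ) :
    P[|{ω | Z ω (⋃ s, B s) = (∑ s, n s : ℕ)}].real {ω | ∀ s, Z ω (B s) = n s} =
      Nat.multinomial Finset.univ n * ∏ s, μ[|⋃ s, B s].real (B s) ^ n s := by
  have hfin s : μ (B s) ≠ ∞ := measure_ne_top_of_subset (subset_iUnion B s) hμ
  have hunion : MeasurableSet (⋃ s, B s) := MeasurableSet.iUnion hB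
  have hreal : μ.real (⋃ s, B s) = ∑ s, μ.real (B s) := measureReal_iUnion_fintype hd hB hfin
  have hsub : {ω | ∀ s, Z ω (B s) = n s} ⊆ {ω | Z ω (⋃ s, B s) = (∑ s, n s : ℕ)} := by
    intro ω hω
    simp [measure_iUnion hd hB, hω.out]
  have hcond s : μ[|⋃ s, B s].real (B s) = μ.real (B s) / ∑ t, μ.real (B t) := by
    rw [measureReal_cond_apply μ hunion, inter_eq_right.mpr (subset_iUnion B s), hreal,
      div_eq_inv_mul]
  rw [measureReal_cond_apply P (hZ.measurableSet_count_eq hunion _), inter_eq_right.mpr hsub,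
    hZ.measureReal_forall_count_eq hB hd, hZ.measureReal_count_eq hunion hμ]
  simp_rw [hcond, hZ.measureReal_count_eq (hB _) (hfin _), hreal]
  exact inv_poisson_mul_prod_poisson_eq_multinomial _ (hreal ▸ (ENNReal.toReal_pos hμ₀ hμ).ne') n

end IsPoissonProcess

theorem sum_dirac_preimage_singleton {α S ι : Type*} [Fintype α] [MeasurableSpace S]
    [DecidableEq ι] (w : α → S) {h : S → ι} {s : ι} (hs : MeasurableSet (h ⁻¹' {s})) :
    (∑ a, Measure.dirac (w a)) (h ⁻¹' {s}) = occurrences (h ∘ w) s := by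
  simp_rw [occurrences, Measure.finsetSum_apply, Measure.dirac_apply' _ hs, Fintype.card_subtype,
    Finset.card_filter, Nat.cast_sum]
  refine Finset.sum_congr rfl fun a _ => ?_
  by_cases ha : h (w a) = s <;> simp [ha]

theorem measurable_comp_perm {α S Ω : Type*} [Finite α] [MeasurableSpace S] [MeasurableSpace Ω]
    {W : Ω → α → S} (hW : Measurable W) {σ : Ω → Equiv.Perm α}
    (hσ : ∀ τ, MeasurableSet (σ ⁻¹' {τ})) : Measurable fun ω => W ω ∘ σ ω := by
  refine measurable_pi_lambda _ fun a B hB => ?_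
  have hunion : (fun ω => W ω (σ ω a)) ⁻¹' B =
      ⋃ τ, σ ⁻¹' {τ} ∩ (fun ω => W ω (τ a)) ⁻¹' B := by
    ext ω
    simp
  exact hunion ▸ MeasurableSet.iUnion fun τ =>
    (hσ τ).inter (((measurable_pi_apply _).comp hW) hB)

-- Testing against indicators suffices: a rectangle `∏ C i` is the preimage of a point set under
-- the finite-valued map that records which of the sets `C i` each coordinate lies in.
theorem eq_pi_of_forall_map_eq_pi {α S : Type*} [Fintype α] [MeasurableSpace S]
    {ρ : Measure (α → S)} {ν : α → Measure S} [∀ a, IsFiniteMeasure (ν a)]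
    (hρ : ∀ f : S → α → Prop, Measurable f →
      ρ.map (fun v a => f (v a)) = Measure.pi fun a => (ν a).map f) :
    ρ = Measure.pi ν := by
  refine (Measure.pi_eq fun C hC => ?_).symm
  let f : S → α → Prop := fun x a => x ∈ C a
  have hf : Measurable f := measurable_pi_lambda _ fun a => measurable_mem.mpr (hC a)
  have hD a : MeasurableSet {p : α → Prop | p a} :=
    measurableSet_setOfPred.mpr (measurable_pi_apply a)
  calc ρ (univ.pi C) = ρ.map (fun v a => f (v a)) (univ.pi fun a => {p | p a}) := by
        rw [Measure.map_apply (by fun_prop) (MeasurableSet.univ_pi hD)]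
        rfl
    _ = ∏ a, (ν a).map f {p | p a} := by rw [hρ f hf, Measure.pi_pi]
    _ = ∏ a, ν a (C a) := Finset.prod_congr rfl fun a _ => Measure.map_apply hf (hD a)

namespace IsPoissonProcess

variable {α S Ω : Type*} [Fintype α] [MeasurableSpace S] [MeasurableSpace Ω]
  {Z : Ω → Measure S} {μ : Measure S} {P : Measure Ω} {T : Set S} {W : Ω → α → S}
  {σ : Ω → Equiv.Perm α}

theorem cond_occurrences_eq_multinomial (hZ : IsPoissonProcess Z μ P) (hT : MeasurableSet T)
    (hμ₀ : μ T ≠ 0) (hμ : μ T ≠ ∞)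
    (hZW : ∀ᵐ ω ∂P[|{ω | Z ω T = Fintype.card α}],
      (Z ω).restrict T = ∑ a, Measure.dirac (W ω a))
    {ι : Type*} [Fintype ι] [DecidableEq ι] [MeasurableSpace ι] [MeasurableSingletonClass ι]
    {h : S → ι} (hh : Measurable h) (v : α → ι) :
    P[|{ω | Z ω T = Fintype.card α}].real {ω | occurrences (h ∘ W ω) = occurrences v} =
      Nat.multinomial Finset.univ (occurrences v) * ∏ a, (μ[|T].map h).real {v a} := by
  have hfiber s : MeasurableSet (h ⁻¹' {s}) := hh (measurableSet_singleton s)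
  have hunion : ⋃ s, T ∩ h ⁻¹' {s} = T := by
    rw [← inter_iUnion, ← preimage_iUnion, iUnion_of_singleton, preimage_univ, inter_univ]
  have hcount : {ω | occurrences (h ∘ W ω) = occurrences v}
      =ᵐ[P[|{ω | Z ω T = Fintype.card α}]] {ω | ∀ s, Z ω (T ∩ h ⁻¹' {s}) = occurrences v s} := by
    filter_upwards [hZW] with ω hω
    have hcell s : Z ω (T ∩ h ⁻¹' {s}) = occurrences (h ∘ W ω) s := by
      rw [inter_comm, ← Measure.restrict_apply (hfiber s), hω,
        sum_dirac_preimage_singleton (W ω) (hfiber s)]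
    refine propext (funext_iff.trans (forall_congr' fun s => ?_))
    rw [hcell, Nat.cast_inj]
  have hmap s : (μ[|T].map h).real {s} = μ[|T].real (T ∩ h ⁻¹' {s}) := by
    rw [map_measureReal_apply hh (measurableSet_singleton s), measureReal_def, measureReal_def,
      cond_inter_self hT]
  have hcells := hZ.cond_count_iUnion_eq_multinomial (B := fun s => T ∩ h ⁻¹' {s})
    (fun s => hT.inter (hfiber s))
    (fun s t hst => ((disjoint_singleton.mpr hst).preimage h).mono inter_subset_right
      inter_subset_right) (by rwa [hunion]) (by rwa [hunion]) (occurrences v)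
  rw [hunion, sum_occurrences] at hcells
  rw [measureReal_congr hcount, hcells, ← prod_pow_occurrences v fun s => (μ[|T].map h).real {s}]
  simp_rw [hmap]

theorem map_finite_labelled_eq_pi [DecidableEq α] (hZ : IsPoissonProcess Z μ P)
    (hT : MeasurableSet T) (hμ₀ : μ T ≠ 0) (hμ : μ T ≠ ∞) (hW : Measurable W)
    (hZW : ∀ᵐ ω ∂P[|{ω | Z ω T = Fintype.card α}],
      (Z ω).restrict T = ∑ a, Measure.dirac (W ω a))
    (hσ : IsIndepUniform σ W P[|{ω | Z ω T = Fintype.card α}])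
    {ι : Type*} [Finite ι] [MeasurableSpace ι] [MeasurableSingletonClass ι]
    {h : S → ι} (hh : Measurable h) :
    P[|{ω | Z ω T = Fintype.card α}].map (fun ω => h ∘ W ω ∘ σ ω) =
      Measure.pi fun _ => μ[|T].map h := by
  classical
  have := Fintype.ofFinite ι
  have hcomp : Measurable fun w : α → S => h ∘ w := by fun_prop
  refine Measure.ext_of_measureReal_singleton fun v => ?_
  have hperm := (hσ.comp_right hcomp).multinomial_mul_measureReal_comp_perm_eq (hcomp.comp hW) v
  have hmultinomial : (Nat.multinomial Finset.univ (occurrences v) : ℝ) ≠ 0 :=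
    mod_cast (Nat.multinomial_pos _ _).ne'
  rw [map_measureReal_apply (f := fun ω => h ∘ W ω ∘ σ ω)
      (hcomp.comp (measurable_comp_perm hW hσ.measurableSet_fiber)) (measurableSet_singleton v),
    measureReal_def (Measure.pi _), Measure.pi_singleton, ENNReal.toReal_prod]
  exact mul_left_cancel₀ hmultinomial <|
    hperm.trans (hZ.cond_occurrences_eq_multinomial hT hμ₀ hμ hZW hh v)

theorem map_labelled_eq_pi [DecidableEq α] (hZ : IsPoissonProcess Z μ P)
    (hT : MeasurableSet T) (hμ₀ : μ T ≠ 0) (hμ : μ T ≠ ∞) (hW : Measurable W)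
    (hZW : ∀ᵐ ω ∂P[|{ω | Z ω T = Fintype.card α}],
      (Z ω).restrict T = ∑ a, Measure.dirac (W ω a))
    (hσ : IsIndepUniform σ W P[|{ω | Z ω T = Fintype.card α}]) :
    P[|{ω | Z ω T = Fintype.card α}].map (fun ω => W ω ∘ σ ω) = Measure.pi fun _ => μ[|T] := by
  refine eq_pi_of_forall_map_eq_pi fun f hf => ?_
  rw [Measure.map_map (by fun_prop) (measurable_comp_perm hW hσ.measurableSet_fiber)]
  exact hZ.map_finite_labelled_eq_pi hT hμ₀ hμ hW hZW hσ hf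

end IsPoissonProcess

section Disintegration

variable {α β : Type*} [MeasurableSpace α] [MeasurableSpace β]

theorem map_withDensity_comp (μ : Measure α) {f : α → β} (hf : Measurable f) {g : β → ℝ≥0∞}
    (hg : Measurable g) : (μ.withDensity (g ∘ f)).map f = (μ.map f).withDensity g := by
  ext s hs
  rw [Measure.map_apply hf hs, withDensity_apply _ (hf hs), withDensity_apply _ hs,
    setLIntegral_map hs hg hf]
  rfl

theorem withDensity_compProd (μ : Measure α) [SFinite μ] (κ : Kernel α β) [IsSFiniteKernel κ]
    {g : α → ℝ≥0∞} (hg : Measurable g) :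
    μ.withDensity g ⊗ₘ κ = (μ ⊗ₘ κ).withDensity (g ∘ Prod.fst) := by
  refine Measure.ext_of_lintegral _ fun φ hφ => ?_
  rw [Measure.lintegral_compProd hφ, lintegral_withDensity_eq_lintegral_mul _ hg
      hφ.lintegral_kernel_prod_right', lintegral_withDensity_eq_lintegral_mul _ (by fun_prop) hφ,
    Measure.lintegral_compProd (by fun_prop)]
  exact lintegral_congr fun a => (lintegral_const_mul _ (by fun_prop)).symm

-- A positive density of the first coordinate makes the measure finite, where the library's
-- disintegration applies, and leaves the kernel unchanged.
theorem exists_isMarkovKernel_fst_compProd_eq [StandardBorelSpace β] [Nonempty β]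
    (ρ : Measure (α × β)) [SigmaFinite ρ.fst] :
    ∃ κ : Kernel α β, IsMarkovKernel κ ∧ ρ.fst ⊗ₘ κ = ρ := by
  obtain ⟨g, hg_pos, hg, hg_lt⟩ := exists_pos_lintegral_lt_of_sigmaFinite ρ.fst one_ne_zero
  let d : α → ℝ≥0∞ := fun a => g a
  have hd : Measurable d := hg.coe_nnreal_ennreal
  have hd₀ a : d a ≠ 0 := by simpa only [d, ENNReal.coe_ne_zero] using (hg_pos a).ne'
  have hd' a : d a ≠ ∞ := ENNReal.coe_ne_top
  let ρ' := ρ.withDensity (d ∘ Prod.fst)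
  have hfst : ρ'.fst = ρ.fst.withDensity d := map_withDensity_comp ρ measurable_fst hd
  have : IsFiniteMeasure ρ' := ⟨by
    rw [← Measure.fst_univ, hfst, withDensity_apply _ .univ, Measure.restrict_univ]
    exact hg_lt.trans ENNReal.one_lt_top⟩
  refine ⟨ρ'.condKernel, inferInstance, ?_⟩
  calc ρ.fst ⊗ₘ ρ'.condKernel
      = ρ'.fst.withDensity (fun a => (d a)⁻¹) ⊗ₘ ρ'.condKernel := by
        rw [hfst, withDensity_inv_same hd (.of_forall hd₀) (.of_forall hd')]
    _ = ρ'.withDensity fun p => (d p.1)⁻¹ := by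
        rw [withDensity_compProd (g := fun a => (d a)⁻¹) _ _ hd.inv, ρ'.disintegrate]
        rfl
    _ = ρ := withDensity_inv_same (hd.comp measurable_fst) (.of_forall fun p => hd₀ p.1)
        (.of_forall fun p => hd' p.1)

theorem inter_sigmaFiniteSet_ae_eq {μ : Measure α} [SFinite μ] {s : Set α} (hs : μ s ≠ ∞) :
    (s ∩ μ.sigmaFiniteSet : Set α) =ᵐ[μ] s := by
  have hnull : μ (s \ μ.sigmaFiniteSet) = 0 :=
    (measure_eq_zero_or_top_of_subset_compl_sigmaFiniteSet fun _ hx => hx.2).resolve_right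
      (measure_ne_top_of_subset sdiff_subset hs)
  rw [← sdiff_sdiff_right_self]
  exact sdiff_null_ae_eq_self hnull

end Disintegration

section ConditionalKernel

variable {S₀ S₁ : Type*} [MeasurableSpace S₀] [MeasurableSpace S₁]

-- Off the σ-finite set of `μ.snd` every set is null or of infinite measure, so only the σ-finite
-- part is seen by the sets of finite measure.
theorem exists_isConditionalKernel [StandardBorelSpace S₀] [Nonempty S₀] (μ : Measure (S₀ × S₁))
    [SFinite μ] : ∃ κ : Kernel S₁ S₀, IsMarkovKernel κ ∧ IsConditionalKernel μ κ := by
  have : SFinite μ.snd := by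
    rw [Measure.snd]
    infer_instance
  let E := μ.snd.sigmaFiniteSet
  have hE : MeasurableSet E := measurableSet_sigmaFiniteSet
  let ρ : Measure (S₁ × S₀) := (μ.restrict (Prod.snd ⁻¹' E)).map Prod.swap
  have hρ : ρ.fst = μ.snd.restrict E := by
    rw [Measure.fst_map_swap, Measure.snd, Measure.snd, Measure.restrict_map measurable_snd hE]
  have : SigmaFinite ρ.fst := hρ ▸ inferInstance
  obtain ⟨κ, hκ_markov, hκ⟩ := exists_isMarkovKernel_fst_compProd_eq ρ
  refine ⟨κ, hκ_markov, fun A hA hA_lt B hB => ?_⟩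
  have hAE := inter_sigmaFiniteSet_ae_eq hA_lt.ne
  have hBAE : (B ×ˢ A ∩ Prod.snd ⁻¹' E : Set (S₀ × S₁)) =ᵐ[μ] B ×ˢ A := by
    filter_upwards [ae_of_ae_map measurable_snd.aemeasurable hAE] with p hp
    have hiff : p.2 ∈ A ∧ p.2 ∈ E ↔ p.2 ∈ A := hp.to_iff
    exact propext (and_assoc.trans (and_congr_right fun _ => hiff))
  calc μ (B ×ˢ A) = ρ (A ×ˢ B) := by
        rw [Measure.map_apply measurable_swap (hA.prod hB), preimage_swap_prod,
          Measure.restrict_apply (hB.prod hA), measure_congr hBAE]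
    _ = ∫⁻ y in A ∩ E, κ y B ∂μ.snd := by
        rw [← hκ, Measure.compProd_apply_prod hA hB, hρ, Measure.restrict_restrict hA]
    _ = ∫⁻ y in A, κ y B ∂μ.snd := setLIntegral_congr hAE

end ConditionalKernel

section ConditionalLaw

variable {S₀ S₁ Ω : Type*} [MeasurableSpace S₀] [MeasurableSpace S₁] [MeasurableSpace Ω]
  {Q : Measure Ω}

theorem hasCondDistrib_of_hasLaw_compProd {X : Ω → S₀} {Y : Ω → S₁} {ν : Measure S₁} [SFinite ν]
    {κ : Kernel S₁ S₀} [IsMarkovKernel κ] (h : HasLaw (fun ω => (Y ω, X ω)) (ν ⊗ₘ κ) Q) :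
    HasCondDistrib X Y κ Q := by
  have hY : Q.map Y = ν := by
    rw [← Measure.fst_map_prodMk₀ h.aemeasurable.snd, h.map_eq, Measure.fst_compProd]
  rwa [HasCondDistrib, hY]

theorem condExp_preimage_ae_eq_of_hasCondDistrib [IsFiniteMeasure Q] {X : Ω → S₀} {Y : Ω → S₁}
    {κ : Kernel S₁ S₀} [IsMarkovKernel κ] (h : HasCondDistrib X Y κ Q) (hY : Measurable Y)
    {B : Set S₀} (hB : MeasurableSet B) :
    Q⟦X ⁻¹' B | MeasurableSpace.comap Y inferInstance⟧ =ᵐ[Q] fun ω => (κ (Y ω)).real B := by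
  have hXB : NullMeasurableSet (X ⁻¹' B) Q := h.aemeasurable_snd.nullMeasurableSet_preimage hB
  have hκB : Measurable fun y => κ y B := Kernel.measurable_coe κ hB
  have hlaw {t : Set S₁} (ht : MeasurableSet t) :
      Q (Y ⁻¹' t ∩ X ⁻¹' B) = ∫⁻ ω in Y ⁻¹' t, κ (Y ω) B ∂Q := by
    rw [← setLIntegral_map ht hκB hY, ← Measure.compProd_apply_prod ht hB, ← h.map_eq,
      Measure.map_apply_of_aemeasurable h.aemeasurable (ht.prod hB), mk_preimage_prod]
  refine (ae_eq_condExp_of_forall_setIntegral_eq hY.comap_le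
    ((integrable_const 1).indicator₀ hXB) (fun t _ _ => Integrable.integrableOn ?_) ?_ ?_).symm
  · refine .of_bound (hκB.ennreal_toReal.comp hY).aestronglyMeasurable 1 (.of_forall fun ω => ?_)
    rw [Real.norm_of_nonneg measureReal_nonneg]
    exact measureReal_le_one
  · rintro _ ⟨t, ht, rfl⟩ -
    rw [integral_indicator₀ (hXB.mono_ac Measure.restrict_le_self.absolutelyContinuous),
      setIntegral_const, smul_eq_mul, mul_one, measureReal_def,
      Measure.restrict_apply₀' (hY ht).nullMeasurableSet, inter_comm, hlaw ht]
    exact integral_toReal (hκB.comp hY).aemeasurable (.of_forall fun ω => measure_lt_top _ _)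
  · exact (hκB.ennreal_toReal.comp (comap_measurable Y)).aestronglyMeasurable

end ConditionalLaw

section ProductKernel

theorem lintegral_pi_prod_eq_prod_lintegral {ι : Type*} [Fintype ι] {α : ι → Type*}
    [∀ i, MeasurableSpace (α i)] (ν : ∀ i, Measure (α i)) [∀ i, IsProbabilityMeasure (ν i)]
    {f : ∀ i, α i → ℝ≥0∞} (hf : ∀ i, Measurable (f i)) :
    ∫⁻ y, ∏ i, f i (y i) ∂Measure.pi ν = ∏ i, ∫⁻ y, f i y ∂ν i := by
  rw [lintegral_prod_eq_prod_lintegral_of_indepFun Finset.univ (fun i (y : ∀ i, α i) => f i (y i))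
    (iIndepFun_pi fun i => (hf i).aemeasurable) fun i => (hf i).comp (measurable_pi_apply i)]
  exact Finset.prod_congr rfl fun i _ => (measurePreserving_eval ν i).lintegral_comp (hf i)

variable {S₀ S₁ Ω : Type*} [MeasurableSpace S₀] [MeasurableSpace S₁] [MeasurableSpace Ω]
  {κ : Kernel S₁ S₀} [IsMarkovKernel κ] {m : ℕ}

instance productKernel.instIsMarkovKernel : IsMarkovKernel (productKernel κ m) :=
  ⟨fun y => inferInstanceAs (IsProbabilityMeasure (Measure.pi fun i => κ (y i)))⟩

theorem productKernel_apply (y : Fin m → S₁) :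
    productKernel κ m y = Measure.pi fun i => κ (y i) := rfl

theorem productKernel_map_eval (i : Fin m) :
    (productKernel κ m).map (fun x => x i) =
      κ.comap (fun y : Fin m → S₁ => y i) (measurable_pi_apply i) := by
  ext1 y
  rw [Kernel.map_apply _ (measurable_pi_apply i), Kernel.comap_apply, productKernel_apply]
  exact (measurePreserving_eval (fun i => κ (y i)) i).map_eq

theorem pi_compProd_eq_map_pi_compProd_productKernel (ν : Fin m → Measure S₁)
    [∀ i, IsProbabilityMeasure (ν i)] :
    Measure.pi (fun i => ν i ⊗ₘ κ) = (Measure.pi ν ⊗ₘ productKernel κ m).map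
      (MeasurableEquiv.arrowProdEquivProdArrow S₁ S₀ (Fin m)).symm := by
  refine Measure.pi_eq fun C hC => ?_
  have hrect := MeasurableSet.univ_pi hC
  have hsection y : productKernel κ m y
      (Prod.mk y ⁻¹' ((MeasurableEquiv.arrowProdEquivProdArrow S₁ S₀ (Fin m)).symm ⁻¹' univ.pi C)) =
        ∏ i, κ (y i) (Prod.mk (y i) ⁻¹' C i) := by
    rw [productKernel_apply, ← Measure.pi_pi]
    rfl
  rw [Measure.map_apply (MeasurableEquiv.measurable _) hrect,
    Measure.compProd_apply (MeasurableEquiv.measurable _ hrect)]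
  simp_rw [hsection, Measure.compProd_apply (hC _)]
  exact lintegral_pi_prod_eq_prod_lintegral ν fun i => Kernel.measurable_kernel_prodMk_left (hC i)

theorem hasCondDistrib_productKernel_of_hasLaw_pi {Q : Measure Ω} {X : Ω → Fin m → S₀}
    {Y : Ω → Fin m → S₁} {ν : Fin m → Measure S₁} [∀ i, IsProbabilityMeasure (ν i)]
    (h : HasLaw (fun ω i => (Y ω i, X ω i)) (Measure.pi fun i => ν i ⊗ₘ κ) Q) :
    HasCondDistrib X Y (productKernel κ m) Q := by
  let e := MeasurableEquiv.arrowProdEquivProdArrow S₁ S₀ (Fin m)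
  refine hasCondDistrib_of_hasLaw_compProd (ν := Measure.pi ν)
    ⟨e.measurable.comp_aemeasurable h.aemeasurable, ?_⟩
  have hlaw : (Q.map fun ω i => (Y ω i, X ω i)).map e = Measure.pi ν ⊗ₘ productKernel κ m := by
    rw [h.map_eq, pi_compProd_eq_map_pi_compProd_productKernel, MeasurableEquiv.map_map_symm]
  rwa [AEMeasurable.map_map_of_aemeasurable e.measurable.aemeasurable h.aemeasurable] at hlaw

theorem hasCondDistrib_eval_of_productKernel {Q : Measure Ω} [SFinite Q] {X : Ω → Fin m → S₀}
    {Y : Ω → Fin m → S₁} (h : HasCondDistrib X Y (productKernel κ m) Q) (i : Fin m) :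
    HasCondDistrib (fun ω => X ω i) Y
      (κ.comap (fun y : Fin m → S₁ => y i) (measurable_pi_apply i)) Q := by
  rw [← productKernel_map_eval]
  exact h.comp_left (measurable_pi_apply i)

theorem condExp_iInter_ae_eq_prod_of_productKernel {Q : Measure Ω} [IsFiniteMeasure Q]
    {X : Ω → Fin m → S₀} {Y : Ω → Fin m → S₁} (h : HasCondDistrib X Y (productKernel κ m) Q)
    (hY : Measurable Y) {B : Fin m → Set S₀} (hB : ∀ i, MeasurableSet (B i)) :
    Q⟦⋂ i, {ω | X ω i ∈ B i} | MeasurableSpace.comap Y inferInstance⟧ =ᵐ[Q]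
      ∏ i, Q⟦{ω | X ω i ∈ B i} | MeasurableSpace.comap Y inferInstance⟧ := by
  have hinter : ⋂ i, {ω | X ω i ∈ B i} = X ⁻¹' univ.pi B := by
    ext ω
    simp
  have hmarginal := ae_all_iff.mpr fun i =>
    condExp_preimage_ae_eq_of_hasCondDistrib (hasCondDistrib_eval_of_productKernel h i) hY (hB i)
  rw [hinter]
  filter_upwards [condExp_preimage_ae_eq_of_hasCondDistrib h hY (MeasurableSet.univ_pi hB),
    hmarginal] with ω hjoint hω
  rw [hjoint, Finset.prod_apply, measureReal_def, productKernel_apply, Measure.pi_pi,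
    ENNReal.toReal_prod]
  exact Finset.prod_congr rfl fun i _ => (hω i).symm

end ProductKernel

theorem observedCount_eq {S₀ S₁ Ω : Type*} [MeasurableSpace S₀] [MeasurableSpace S₁]
    {Z : Ω → Measure (S₀ × S₁)} {A : Set S₁} (hA : MeasurableSet A) {m : ℕ} :
    observedCount Z A m = {ω | Z ω (Prod.snd ⁻¹' A) = m} := by
  simp only [observedCount, Measure.snd_apply hA]

section UniformLabelling

variable {S₀ S₁ Ω : Type*} [MeasurableSpace S₀] [MeasurableSpace S₁] [MeasurableSpace Ω]
  {μ : Measure (S₀ × S₁)} {P : Measure Ω} {Z : Ω → Measure (S₀ × S₁)} {A : Set S₁} {m : ℕ}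
  {X : Ω → Fin m → S₀} {Y : Ω → Fin m → S₁}

theorem IsConditionalKernel.map_swap_cond_eq_compProd {κ : Kernel S₁ S₀} [IsMarkovKernel κ]
    (hκ : IsConditionalKernel μ κ) (hA : MeasurableSet A) (hμA : μ.snd A ≠ ∞) :
    (μ[|Prod.snd ⁻¹' A]).map Prod.swap = μ.snd[|A] ⊗ₘ κ := by
  have hA' : MeasurableSet (Prod.snd ⁻¹' A : Set (S₀ × S₁)) := measurable_snd hA
  refine Measure.ext_prod fun {C B} hC hB => ?_
  have hCA : μ.snd (C ∩ A) < ∞ := (measure_mono inter_subset_right).trans_lt hμA.lt_top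
  have hset : Prod.snd ⁻¹' A ∩ B ×ˢ C = B ×ˢ (C ∩ A) := by
    ext p
    simp only [mem_inter_iff, mem_preimage, mem_prod]
    tauto
  calc (μ[|Prod.snd ⁻¹' A]).map Prod.swap (C ×ˢ B)
      = (μ.snd A)⁻¹ * μ (B ×ˢ (C ∩ A)) := by
        rw [Measure.map_apply measurable_swap (hC.prod hB), preimage_swap_prod, cond_apply hA',
          hset, Measure.snd_apply hA]
    _ = (μ.snd A)⁻¹ * ∫⁻ y in C ∩ A, κ y B ∂μ.snd := by rw [hκ _ (hC.inter hA) hCA B hB]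
    _ = (μ.snd[|A] ⊗ₘ κ) (C ×ˢ B) := by
        rw [Measure.compProd_apply_prod hC hB, ProbabilityTheory.cond, Measure.restrict_smul,
          lintegral_smul_measure, Measure.restrict_restrict hC, smul_eq_mul]

theorem IsPoissonProcess.measure_observedCount_pos (hZ : IsPoissonProcess Z μ P)
    (hA : MeasurableSet A) (hμA₀ : μ.snd A ≠ 0) (hμA : μ.snd A ≠ ∞) (m : ℕ) :
    0 < P (observedCount Z A m) := by
  rw [Measure.snd_apply hA] at hμA₀ hμA
  rw [observedCount_eq hA]
  exact (ENNReal.toReal_pos_iff.mp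
    (hZ.measureReal_count_eq_pos (measurable_snd hA) hμA₀ hμA m)).1

theorem IsUniformLabelling.exists_isIndepUniform (h : IsUniformLabelling P Z A m X Y) :
    ∃ (W : Ω → Fin m → S₀ × S₁) (σ : Ω → Equiv.Perm (Fin m)), Measurable W ∧
      (∀ᵐ ω ∂P[|observedCount Z A m],
        (Z ω).restrict (Prod.snd ⁻¹' A) = ∑ i, Measure.dirac (W ω i)) ∧
      IsIndepUniform σ W P[|observedCount Z A m] ∧
      (fun ω i => (X ω i, Y ω i)) = fun ω => W ω ∘ σ ω := by
  obtain ⟨W, σ, hW, hZW, hσ, hunif, hindep, hXY⟩ := h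
  have hσZW : IsIndepUniform σ (fun ω => (Z ω, W ω)) P[|observedCount Z A m] :=
    ⟨hσ, by simpa only [Fintype.card_perm, Fintype.card_fin] using hunif, hindep⟩
  exact ⟨W, σ, hW, hZW, hσZW.comp_right measurable_snd, funext fun ω => funext (hXY ω)⟩

theorem IsUniformLabelling.measurable_labelled (h : IsUniformLabelling P Z A m X Y) :
    Measurable fun ω i => (X ω i, Y ω i) := by
  obtain ⟨W, σ, hW, -, hσ, hXY⟩ := h.exists_isIndepUniform
  exact hXY ▸ measurable_comp_perm hW hσ.measurableSet_fiber

theorem IsUniformLabelling.measurable_labelled_snd (h : IsUniformLabelling P Z A m X Y) :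
    Measurable Y :=
  measurable_pi_lambda _ fun i => (measurable_pi_iff.mp h.measurable_labelled i).snd

theorem IsUniformLabelling.hasLaw_pi_cond (h : IsUniformLabelling P Z A m X Y)
    (hZ : IsPoissonProcess Z μ P) (hA : MeasurableSet A) (hμA₀ : μ.snd A ≠ 0)
    (hμA : μ.snd A ≠ ∞) :
    HasLaw (fun ω i => (X ω i, Y ω i)) (Measure.pi fun _ => μ[|Prod.snd ⁻¹' A])
      P[|observedCount Z A m] := by
  refine ⟨h.measurable_labelled.aemeasurable, ?_⟩
  obtain ⟨W, σ, hW, hZW, hσ, hXY⟩ := h.exists_isIndepUniform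
  have hevent : observedCount Z A m = {ω | Z ω (Prod.snd ⁻¹' A) = Fintype.card (Fin m)} := by
    rw [observedCount_eq hA, Fintype.card_fin]
  rw [Measure.snd_apply hA] at hμA₀ hμA
  rw [hevent] at hZW hσ ⊢
  rw [hXY]
  exact hZ.map_labelled_eq_pi (measurable_snd hA) hμA₀ hμA hW hZW hσ

theorem IsUniformLabelling.hasCondDistrib_productKernel (h : IsUniformLabelling P Z A m X Y)
    (hZ : IsPoissonProcess Z μ P) {κ : Kernel S₁ S₀} [IsMarkovKernel κ]
    (hκ : IsConditionalKernel μ κ) (hA : MeasurableSet A) (hμA₀ : μ.snd A ≠ 0)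
    (hμA : μ.snd A ≠ ∞) : HasCondDistrib X Y (productKernel κ m) P[|observedCount Z A m] := by
  have : IsProbabilityMeasure μ.snd[|A] := cond_isProbabilityMeasure_of_finite hμA₀ hμA
  have hswap : HasLaw (fun (v : Fin m → S₀ × S₁) i => (v i).swap)
      (Measure.pi fun _ => μ.snd[|A] ⊗ₘ κ) (Measure.pi fun _ => μ[|Prod.snd ⁻¹' A]) := by
    refine ⟨(measurable_pi_lambda _ fun i =>
      measurable_swap.comp (measurable_pi_apply i)).aemeasurable, ?_⟩
    rw [← hκ.map_swap_cond_eq_compProd hA hμA]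
    exact Measure.pi_map_pi fun _ => measurable_swap.aemeasurable
  exact hasCondDistrib_productKernel_of_hasLaw_pi (hswap.comp (h.hasLaw_pi_cond hZ hA hμA₀ hμA))

end UniformLabelling

theorem mainTheorem1_general {S₀ S₁ Ω : Type*} [MeasurableSpace S₀] [MeasurableSpace S₁]
    [MeasurableSpace Ω] (μ : Measure (S₀ × S₁)) (P : Measure Ω) (Z : Ω → Measure (S₀ × S₁))
    (hZ : IsPoissonProcess Z μ P) :
    (SFinite μ → StandardBorelSpace S₀ → Nonempty S₀ →
      ∃ κ : Kernel S₁ S₀, IsMarkovKernel κ ∧ IsConditionalKernel μ κ) ∧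
    ∀ (κ : Kernel S₁ S₀) [IsMarkovKernel κ], IsConditionalKernel μ κ →
      ∀ A : Set S₁, MeasurableSet A → 0 < μ.snd A → μ.snd A < ∞ → ∀ m : ℕ,
      0 < P (observedCount Z A m) ∧
      ∀ (X : Ω → Fin m → S₀) (Y : Ω → Fin m → S₁), IsUniformLabelling P Z A m X Y →
        HasCondDistrib X Y (productKernel κ m) P[|observedCount Z A m] ∧
        (∀ B : Fin m → Set S₀, (∀ i, MeasurableSet (B i)) →
          (P[|observedCount Z A m])⟦⋂ i, {ω | X ω i ∈ B i} | MeasurableSpace.comap Y inferInstance⟧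
            =ᵐ[P[|observedCount Z A m]]
          ∏ i, (P[|observedCount Z A m])⟦{ω | X ω i ∈ B i} |
            MeasurableSpace.comap Y inferInstance⟧) ∧
        (∀ i, HasCondDistrib (fun ω => X ω i) Y
          (κ.comap (fun y : Fin m → S₁ => y i) (measurable_pi_apply i))
          P[|observedCount Z A m]) := by
  refine ⟨fun _ _ _ => exists_isConditionalKernel μ, fun κ _ hκ A hA hA₀ hA_lt m =>
    ⟨hZ.measure_observedCount_pos hA hA₀.ne' hA_lt.ne m, fun X Y hXY => ?_⟩⟩
  have hjoint := hXY.hasCondDistrib_productKernel hZ hκ hA hA₀.ne' hA_lt.ne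
  exact ⟨hjoint,
    fun B hB => condExp_iInter_ae_eq_prod_of_productKernel hjoint hXY.measurable_labelled_snd hB,
    hasCondDistrib_eval_of_productKernel hjoint⟩

theorem mainTheorem1 {S₀ S₁ Ω : Type*} [MeasurableSpace S₀] [MeasurableSingletonClass S₀]
    [MeasurableSpace S₁] [MeasurableSingletonClass S₁] [MeasurableSpace Ω]
    (μ : Measure (S₀ × S₁)) [SFinite μ] (P : Measure Ω) [IsProbabilityMeasure P]
    (Z : Ω → Measure (S₀ × S₁)) (hZ : IsPoissonProcess Z μ P) :
    -- the conditional measures `μ(dx | y)` exist, for one choice of kernel valid for all test sets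
    (StandardBorelSpace S₀ → Nonempty S₀ →
      ∃ κ : Kernel S₁ S₀, IsMarkovKernel κ ∧ IsConditionalKernel μ κ) ∧
    -- and, for every version of them, every test set and every number of observed events,
    ∀ (κ : Kernel S₁ S₀) [IsMarkovKernel κ], IsConditionalKernel μ κ →
      ∀ A : Set S₁, MeasurableSet A → 0 < μ.snd A → μ.snd A < ∞ → ∀ m : ℕ,
      -- `#(Y ∩ A) = m` has positive probability, and
      0 < P (observedCount Z A m) ∧
      ∀ (X : Ω → Fin m → S₀) (Y : Ω → Fin m → S₁), IsUniformLabelling P Z A m X Y →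
        -- the conditional law of `(X₁, …, Xₘ)` given `(Y₁, …, Yₘ)` is `∏ᵢ μ(dxᵢ | yᵢ)`,
        HasCondDistrib X Y (productKernel κ m) P[|observedCount Z A m] ∧
        -- `X₁, …, Xₘ` are conditionally independent given `(Y₁, …, Yₘ)`,
        (∀ B : Fin m → Set S₀, (∀ i, MeasurableSet (B i)) →
          (P[|observedCount Z A m])⟦⋂ i, {ω | X ω i ∈ B i} | MeasurableSpace.comap Y inferInstance⟧
            =ᵐ[P[|observedCount Z A m]]
          ∏ i, (P[|observedCount Z A m])⟦{ω | X ω i ∈ B i} |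
            MeasurableSpace.comap Y inferInstance⟧) ∧
        -- and the conditional law of `Xᵢ` given all of `(Y₁, …, Yₘ)` is `μ(dx | Yᵢ)`
        (∀ i, HasCondDistrib (fun ω => X ω i) Y
          (κ.comap (fun y : Fin m → S₁ => y i) (measurable_pi_apply i))
          P[|observedCount Z A m]) :=
  have h := mainTheorem1_general μ P Z hZ
  ⟨h.1 inferInstance, h.2⟩
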